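/- Let $n\ge 1$. For a complex manifold $Z$ with a holomorphic distribution $D\subset TZ$ of rank $n$, its prolongation is the manifold $\mathbb P D=\{(z,\ell): z\in Z,\ \ell\subset D(z)\text{ a line}\}$ with projection $\pi:\mathbb PD\to Z$, endowed with the rank $n$ distribution $D^1(z,\ell)=d\pi_{(z,\ell)}^{-1}(\ell)$. The Monster tower is obtained by iterating: $(\mathcal P^0(n),\Delta_0)=(\mathbb C^n,T\mathbb C^n)$ and $(\mathcal P^{k+1}(n),\Delta_{k+1})=(\mathbb P\Delta_k,\Delta_k^1)$. Let $p\in\mathcal P^k(n)$ and let $p_i\in\mathcal P^i(n)$ ($0\le i\le k$) be its projections. For $1\le i\le k$ let $F_i=\mathcal P^0(F_i)\subset\mathcal P^i(n)$ be the fiber of $\mathcal P^i(n)\to\mathcal P^{i-1}(n)$ through $p_i$, and define inductively the submanifolds $\mathcal P^{j}(F_i)\subset\mathcal P^{i+j}(n)$ with distributions $$\delta_i^j(q)=\Delta_{i+j}(q)\cap T_q\mathcal P^j(F_i),\qquad \mathcal P^{j+1}(F_i)=\{(q,\ell): q\in\mathcal P^j(F_i),\ \ell\subset\delta_i^j(q)\text{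 a line}\}.$$ The critical hyperplanes through $p$ are the subspaces $\delta_i^{j}(p)\subset\Delta_k(p)$, where $i\geq 1$, $j\ge 0$, $i+j=k$ and $p\in\mathcal P^{j}(F_i)$; they form a family indexed by these $i$. A family $(\Lambda_i)_{i\in I}$ of linear hyperplanes in a finite-dimensional vector space $V$ is in general position if for every finite $J\subset I$ with $|J|\le\dim V$ the codimension of $\bigcap_{i\in J}\Lambda_i$ in $V$ equals $|J|$. **Theorem.** For all $n\ge 1$, $k\ge 0$ and $p\in\mathcal P^k(n)$, the critical hyperplanes through $p$ are hyperplanes of $\Delta_k(p)$ and are in general position within $\Delta_k(p)$, and there are at most $n$ of them. -/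

import Mathlib

open scoped Manifold ContDiff LinearAlgebra.Projectivization Topology

noncomputable section

/-- A complex manifold `Z` (modelled on `E`) with a holomorphic distribution `D` of rank `m + 1`.
That `D` is a holomorphic subbundle of rank `m + 1` of the tangent bundle is recorded by local
frames: over the domain of the preferred chart at `z₀`, and read in that chart, `D` has the analytic
frame `frame z₀ 0, …, frame z₀ m`, with an analytic dual coframe `coframe z₀`. -/
structure DistMfd (m : ℕ) where
  E : Type
  [instNACG : NormedAddCommGroup E]
  [instNS : NormedSpace ℂ E]
  Z : Type
  [instTop : TopologicalSpace Z]
  [instCharted : ChartedSpace E Z]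
  [instMfd : IsManifold 𝓘(ℂ, E) ω Z]
  /-- the distribution -/
  D : ∀ z : Z, Submodule ℂ (TangentSpace 𝓘(ℂ, E) z)
  frame : Z → Fin (m + 1) → E → E
  coframe : Z → E → E →L[ℂ] (Fin (m + 1) → ℂ)
  frame_analytic : ∀ z₀ j, ContDiffOn ℂ ω (frame z₀ j) (chartAt E z₀).target
  coframe_analytic : ∀ z₀, ContDiffOn ℂ ω (coframe z₀) (chartAt E z₀).target
  coframe_frame : ∀ z₀, ∀ x ∈ (chartAt E z₀).target, ∀ j,
    coframe z₀ x (frame z₀ j x) = Pi.single j 1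
  map_D : ∀ z₀, ∀ z ∈ (chartAt E z₀).source,
    (D z).map (mfderiv 𝓘(ℂ, E) 𝓘(ℂ, E) (chartAt E z₀) z).toLinearMap =
      Submodule.span ℂ (Set.range fun j => frame z₀ j (chartAt E z₀ z))

namespace DistMfd

attribute [instance] instNACG instNS instTop instCharted instMfd

variable {m : ℕ} (X : DistMfd m)

/-- The preferred chart of `Z` at `z₀`. -/
abbrev chart (z₀ : X.Z) : OpenPartialHomeomorph X.Z X.E := chartAt X.E z₀

/-- The derivative at `z` of the chart at `z₀`. -/
def dchart (z₀ z : X.Z) : TangentSpace 𝓘(ℂ, X.E) z →L[ℂ] X.E :=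
  mfderiv 𝓘(ℂ, X.E) 𝓘(ℂ, X.E) (X.chart z₀) z

/-! ### The projectivization `ℙD` as a complex manifold -/

/-- The points of `ℙD`: the pairs `(z, ℓ)` with `z ∈ Z` and `ℓ` a line in `T_z Z` contained in
`D(z)`. -/
structure PD where
  base : X.Z
  line : ℙ ℂ (TangentSpace 𝓘(ℂ, X.E) base)
  line_le : line.submodule ≤ X.D base

/-- Homogeneous coordinates of the line `ℓ` of `q = (z, ℓ)` in the frame of `D` at `z₀`
(for the chosen spanning vector of `ℓ`). -/
def coord (z₀ : X.Z) (q : X.PD) : Fin (m + 1) → ℂ :=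
  X.coframe z₀ (X.chart z₀ q.base) (X.dchart z₀ q.base q.line.rep)

/-- The points `(z, ℓ)` over the chart at `z₀` whose `i`-th homogeneous coordinate is nonzero. -/
def affSource (z₀ : X.Z) (i : Fin (m + 1)) : Set X.PD :=
  {q | q.base ∈ (X.chart z₀).source ∧ X.coord z₀ q i ≠ 0}

/-- Affine coordinates on `ℙD`: the coordinates of `z` in the chart at `z₀`, and the homogeneous
coordinates of `ℓ` divided by the `i`-th one. -/
def affCoord (z₀ : X.Z) (i : Fin (m + 1)) (q : X.PD) : X.E × (Fin m → ℂ) :=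
  (X.chart z₀ q.base, fun j => X.coord z₀ q (i.succAbove j) / X.coord z₀ q i)

/-- `∑ aⱼ eⱼ(x)` with `aᵢ = 1` and the other coefficients given by `u`. -/
def affVec (z₀ : X.Z) (i : Fin (m + 1)) (y : X.E × (Fin m → ℂ)) : X.E :=
  ∑ j, (i.insertNth 1 y.2 : Fin (m + 1) → ℂ) j • X.frame z₀ j y.1

theorem dchart_bijective {z₀ z : X.Z} (hz : z ∈ (X.chart z₀).source) :
    Function.Bijective (X.dchart z₀ z) :=
  (mdifferentiable_chart (I := 𝓘(ℂ, X.E)) z₀).mfderiv_bijective hz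

theorem coframe_sum {z₀ : X.Z} {x : X.E} (hx : x ∈ (X.chart z₀).target)
    (a : Fin (m + 1) → ℂ) : X.coframe z₀ x (∑ j, a j • X.frame z₀ j x) = a := by
  rw [map_sum]
  simp only [map_smul, X.coframe_frame z₀ x hx]
  ext k
  simp [Pi.single_apply]

theorem dchart_eq_sum {z₀ z : X.Z} (hz : z ∈ (X.chart z₀).source)
    {v : TangentSpace 𝓘(ℂ, X.E) z} (hv : v ∈ X.D z) :
    X.dchart z₀ z v = ∑ j, X.coframe z₀ (X.chart z₀ z) (X.dchart z₀ z v) j •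
      X.frame z₀ j (X.chart z₀ z) := by
  have h : X.dchart z₀ z v ∈ (X.D z).map (X.dchart z₀ z).toLinearMap :=
    Submodule.mem_map_of_mem hv
  have h2 := X.map_D z₀ z hz
  erw [h2, Submodule.mem_span_range_iff_exists_fun] at h
  obtain ⟨c, hc⟩ := h
  rw [← hc, X.coframe_sum ((X.chart z₀).map_source hz)]

/-- `D` has rank `m + 1`. -/
theorem finrank_D (z : X.Z) : Module.finrank ℂ (X.D z) = m + 1 := by
  have hz : z ∈ (X.chart z).source := mem_chart_source X.E z
  have hx := (X.chart z).map_source hz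
  have hli : LinearIndependent ℂ fun j => X.frame z j (X.chart z z) := by
    rw [Fintype.linearIndependent_iff]
    intro g hg j
    have := X.coframe_sum hx g
    rw [hg, map_zero] at this
    exact (congrFun this j).symm
  have h1 := finrank_span_eq_card hli
  rw [Fintype.card_fin] at h1
  have h2 := X.map_D z z hz
  have h3 : Module.finrank ℂ ((X.D z).map (X.dchart z z).toLinearMap) = m + 1 :=
    Eq.trans (congrArg (fun S : Submodule ℂ X.E => Module.finrank ℂ S) h2) h1
  rw [← h3]
  exact (Submodule.equivMapOfInjective _ (X.dchart_bijective hz).1 _).finrank_eq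

theorem rep_mem (q : X.PD) : q.line.rep ∈ X.D q.base := by
  apply q.line_le
  rw [Projectivization.submodule_eq]
  exact Submodule.mem_span_singleton_self _

theorem insertNth_ratio (i : Fin (m + 1)) (a : Fin (m + 1) → ℂ) (h : a i ≠ 0) :
    a i • (i.insertNth 1 (fun j => a (i.succAbove j) / a i) : Fin (m + 1) → ℂ) = a := by
  ext k
  refine Fin.succAboveCases i ?_ (fun j => ?_) k
  · simp
  · simp [mul_div_cancel₀, h]

theorem dchart_rep {z₀ : X.Z} {i : Fin (m + 1)} {q : X.PD} (hq : q ∈ X.affSource z₀ i) :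
    X.dchart z₀ q.base q.line.rep = X.coord z₀ q i • X.affVec z₀ i (X.affCoord z₀ i q) := by
  rw [X.dchart_eq_sum hq.1 (X.rep_mem q), affVec, Finset.smul_sum]
  refine Finset.sum_congr rfl fun j _ => ?_
  rw [smul_smul]
  congr 1
  exact (congrFun (insertNth_ratio i (X.coord z₀ q) hq.2) j).symm

theorem affCoord_bijOn (z₀ : X.Z) (i : Fin (m + 1)) :
    Set.BijOn (X.affCoord z₀ i) (X.affSource z₀ i) ((X.chart z₀).target ×ˢ Set.univ) := by
  refine ⟨fun q hq => ⟨(X.chart z₀).map_source hq.1, trivial⟩, ?_, ?_⟩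
  · intro q hq q' hq' h
    have hb : q.base = q'.base :=
      (X.chart z₀).injOn hq.1 hq'.1 (congrArg Prod.fst h)
    have e1 := X.dchart_rep hq
    have e2 := X.dchart_rep hq'
    rw [← h] at e2
    have ha := hq.2
    have ha' := hq'.2
    generalize X.affVec z₀ i (X.affCoord z₀ i q) = w at e1 e2
    generalize X.coord z₀ q i = a at e1 ha
    generalize X.coord z₀ q' i = a' at e2 ha'
    have hs := hq.1
    clear h hq hq'
    obtain ⟨z, l, hl⟩ := q
    obtain ⟨z', l', hl'⟩ := q'
    obtain rfl : z = z' := hb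
    have : l = l' := by
      rw [← l.mk_rep, ← l'.mk_rep, Projectivization.mk_eq_mk_iff']
      refine ⟨a * a'⁻¹, ?_⟩
      apply (X.dchart_bijective hs).1
      rw [map_smul]
      simp only at e1 e2
      rw [e1, e2, smul_smul, mul_assoc, inv_mul_cancel₀ ha', mul_one]
    subst this
    rfl
  · rintro ⟨x, u⟩ ⟨hx, -⟩
    have hx : x ∈ (X.chart z₀).target := hx
    set z := (X.chart z₀).symm x with hz
    have hzs : z ∈ (X.chart z₀).source := (X.chart z₀).map_target hx
    have hzx : X.chart z₀ z = x := (X.chart z₀).right_inv hx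
    have hw : X.affVec z₀ i (x, u) ∈ (X.D z).map (X.dchart z₀ z).toLinearMap := by
      have h2 := X.map_D z₀ z hzs
      erw [h2, Submodule.mem_span_range_iff_exists_fun]
      exact ⟨(i.insertNth 1 u : Fin (m + 1) → ℂ), by erw [hzx]; rfl⟩
    obtain ⟨v, hvD, hv⟩ := hw
    have hv : X.dchart z₀ z v = X.affVec z₀ i (x, u) := hv
    have hc : X.coframe z₀ x (X.dchart z₀ z v) = (i.insertNth 1 u : Fin (m + 1) → ℂ) := by
      rw [hv]; exact X.coframe_sum hx _
    have hv0 : v ≠ 0 := by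
      rintro rfl
      have := congrFun hc i
      simp at this
    have hle : (Projectivization.mk ℂ v hv0).submodule ≤ X.D z := by
      rw [Projectivization.submodule_mk, Submodule.span_singleton_le_iff_mem]
      exact hvD
    obtain ⟨a, ha⟩ := Projectivization.exists_smul_eq_mk_rep ℂ v hv0
    have hco : X.coord z₀ ⟨z, _, hle⟩ = (a : ℂ) • (i.insertNth 1 u : Fin (m + 1) → ℂ) := by
      simp only [coord]
      rw [← ha, hzx, Units.smul_def, map_smul, map_smul, hc]
    refine ⟨⟨z, _, hle⟩, ⟨hzs, ?_⟩, ?_⟩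
    · rw [hco]; simp
    · refine Prod.ext hzx ?_
      ext j
      simp only [affCoord, hco]
      simp

theorem PD.nonempty (z₀ : X.Z) : Nonempty X.PD :=
  let ⟨q, _⟩ := (X.affCoord_bijOn z₀ 0).surjOn
    (show (X.chart z₀ z₀, (0 : Fin m → ℂ)) ∈ (X.chart z₀).target ×ˢ Set.univ from
      ⟨(X.chart z₀).map_source (mem_chart_source X.E z₀), trivial⟩)
  ⟨q⟩

/-- The affine chart of `ℙD` with coordinates `affCoord z₀ i`. -/
def affChart (z₀ : X.Z) (i : Fin (m + 1)) : PartialEquiv X.PD (X.E × (Fin m → ℂ)) :=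
  haveI := PD.nonempty X z₀
  (X.affCoord_bijOn z₀ i).toPartialEquiv (X.affCoord z₀ i) _ _

theorem affChart_coe (z₀ : X.Z) (i : Fin (m + 1)) (q : X.PD) :
    X.affChart z₀ i q = X.affCoord z₀ i q := rfl

theorem affChart_source (z₀ : X.Z) (i : Fin (m + 1)) :
    (X.affChart z₀ i).source = X.affSource z₀ i := rfl

theorem affChart_target (z₀ : X.Z) (i : Fin (m + 1)) :
    (X.affChart z₀ i).target = (X.chart z₀).target ×ˢ Set.univ := rfl

theorem coord_ne_zero (q : X.PD) : X.coord q.base q ≠ 0 := by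
  intro h
  have hz := mem_chart_source X.E q.base
  have h2 := X.dchart_eq_sum hz (X.rep_mem q)
  have h3 : ∀ j, X.coframe q.base (X.chart q.base q.base)
    (X.dchart q.base q.base q.line.rep) j = 0 := fun j => congrFun h j
  simp only [h3, zero_smul, Finset.sum_const_zero] at h2
  exact q.line.rep_nonzero ((X.dchart_bijective hz).1 (h2.trans (map_zero _).symm))

theorem exists_coord_ne_zero (q : X.PD) : ∃ i, X.coord q.base q i ≠ 0 :=
  Function.ne_iff.mp (X.coord_ne_zero q)

/-- A nonvanishing homogeneous coordinate of the line of `q`. -/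
def idx (q : X.PD) : Fin (m + 1) := (X.exists_coord_ne_zero q).choose

theorem mem_affSource (q : X.PD) : q ∈ X.affSource q.base (X.idx q) :=
  ⟨mem_chart_source X.E q.base, (X.exists_coord_ne_zero q).choose_spec⟩

/-- The transition map between two charts of `Z`. -/
def trans (z₀ z₁ : X.Z) : X.E → X.E := X.chart z₁ ∘ (X.chart z₀).symm

/-- The domain of the transition map `trans z₀ z₁`. -/
def transSource (z₀ z₁ : X.Z) : Set X.E := ((X.chart z₀).symm.trans (X.chart z₁)).source

theorem isOpen_transSource (z₀ z₁ : X.Z) : IsOpen (X.transSource z₀ z₁) :=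
  ((X.chart z₀).symm.trans (X.chart z₁)).open_source

theorem trans_analytic (z₀ z₁ : X.Z) :
    ContDiffOn ℂ ω (X.trans z₀ z₁) (X.transSource z₀ z₁) := by
  rw [← contMDiffOn_iff_contDiffOn]
  refine (contMDiffOn_chart (I := 𝓘(ℂ, X.E)) (n := ω) (x := z₁)).comp
    ((contMDiffOn_chart_symm (I := 𝓘(ℂ, X.E)) (n := ω) (x := z₀)).mono fun x hx => ?_)
    fun x hx => ?_
  · simp only [transSource, mfld_simps] at hx; exact hx.1
  · simp only [transSource, mfld_simps] at hx; exact hx.2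

theorem dchart_trans {z₀ z₁ z : X.Z} (h₀ : z ∈ (X.chart z₀).source)
    (h₁ : z ∈ (X.chart z₁).source) (v : TangentSpace 𝓘(ℂ, X.E) z) :
    X.dchart z₁ z v = fderiv ℂ (X.trans z₀ z₁) (X.chart z₀ z) (X.dchart z₀ z v) := by
  have hx : X.chart z₀ z ∈ X.transSource z₀ z₁ := by
    simp only [transSource, mfld_simps]
    exact ⟨(X.chart z₀).map_source h₀, by rwa [(X.chart z₀).left_inv h₀]⟩
  have hd : MDifferentiableAt 𝓘(ℂ, X.E) 𝓘(ℂ, X.E) (X.trans z₀ z₁) (X.chart z₀ z) :=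
    (((X.trans_analytic z₀ z₁).differentiableOn (by simp)).differentiableAt
      ((X.isOpen_transSource z₀ z₁).mem_nhds hx)).mdifferentiableAt
  have hc : MDifferentiableAt 𝓘(ℂ, X.E) 𝓘(ℂ, X.E) (X.chart z₀) z :=
    mdifferentiableAt_atlas (chart_mem_atlas X.E z₀) h₀
  have he : (X.chart z₁ : X.Z → X.E) =ᶠ[𝓝 z] X.trans z₀ z₁ ∘ X.chart z₀ := by
    filter_upwards [(X.chart z₀).open_source.mem_nhds h₀] with y hy
    simp [trans, (X.chart z₀).left_inv hy]
  have h2 := mfderiv_comp z hd hc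
  rw [← he.mfderiv_eq, mfderiv_eq_fderiv] at h2
  exact congrArg (fun f => f v) h2

theorem affVec_analytic (z₀ : X.Z) (i : Fin (m + 1)) :
    ContDiffOn ℂ ω (X.affVec z₀ i) ((X.chart z₀).target ×ˢ Set.univ) := by
  unfold affVec
  refine ContDiffOn.sum fun j _ => ContDiffOn.smul ?_ ?_
  · refine Fin.succAboveCases i ?_ (fun k => ?_) j
    · simpa using contDiffOn_const
    · simp only [Fin.insertNth_apply_succAbove]
      fun_prop
  · exact (X.frame_analytic z₀ j).comp contDiffOn_fst fun y hy => hy.1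

/-- The homogeneous coordinates in the frame at `z₁` of the line with coordinates `y`. -/
def transVec (z₀ z₁ : X.Z) (i : Fin (m + 1)) (y : X.E × (Fin m → ℂ)) : Fin (m + 1) → ℂ :=
  X.coframe z₁ (X.trans z₀ z₁ y.1) (fderiv ℂ (X.trans z₀ z₁) y.1 (X.affVec z₀ i y))

theorem transVec_analytic (z₀ z₁ : X.Z) (i : Fin (m + 1)) :
    ContDiffOn ℂ ω (X.transVec z₀ z₁ i) (X.transSource z₀ z₁ ×ˢ Set.univ) := by
  have hs : X.transSource z₀ z₁ ⊆ (X.chart z₀).target := by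
    intro x hx; simp only [transSource, mfld_simps] at hx; exact hx.1
  have ht : Set.MapsTo (X.trans z₀ z₁) (X.transSource z₀ z₁) (X.chart z₁).target := by
    intro x hx; simp only [transSource, mfld_simps] at hx
    exact (X.chart z₁).map_source hx.2
  unfold transVec
  refine ContDiffOn.clm_apply ?_ (ContDiffOn.clm_apply ?_ ?_)
  · exact (X.coframe_analytic z₁).comp
      ((X.trans_analytic z₀ z₁).comp contDiffOn_fst fun y hy => hy.1) fun y hy => ht hy.1
  · exact ((X.trans_analytic z₀ z₁).fderiv_of_isOpen (X.isOpen_transSource z₀ z₁) le_rfl).comp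
      contDiffOn_fst fun y hy => hy.1
  · exact (X.affVec_analytic z₀ i).mono (Set.prod_mono hs subset_rfl)

theorem coord_trans {z₀ z₁ : X.Z} {i : Fin (m + 1)} {q : X.PD} (hq : q ∈ X.affSource z₀ i)
    (h₁ : q.base ∈ (X.chart z₁).source) :
    X.coord z₁ q = X.coord z₀ q i • X.transVec z₀ z₁ i (X.affCoord z₀ i q) := by
  rw [coord, X.dchart_trans hq.1 h₁, X.dchart_rep hq, map_smul, map_smul, transVec]
  simp [affCoord, trans, (X.chart z₀).left_inv hq.1]

theorem affTrans_source (z₀ z₁ : X.Z) (i i' : Fin (m + 1)) :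
    ((X.affChart z₀ i).symm.trans (X.affChart z₁ i')).source =
      (X.transSource z₀ z₁ ×ˢ Set.univ) ∩ {y | X.transVec z₀ z₁ i y i' ≠ 0} := by
  ext y
  simp only [PartialEquiv.trans_source, PartialEquiv.symm_source, affChart_source,
    affChart_target, Set.mem_inter_iff, Set.mem_preimage, Set.mem_prod, Set.mem_univ, and_true,
    Set.mem_ofPred_eq]
  have key : y.1 ∈ (X.chart z₀).target → ((X.affChart z₀ i).symm y).base = (X.chart z₀).symm y.1 ∧
      X.affCoord z₀ i ((X.affChart z₀ i).symm y) = y ∧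
      (X.affChart z₀ i).symm y ∈ X.affSource z₀ i := by
    intro hy
    have hy' : y ∈ (X.affChart z₀ i).target := ⟨hy, trivial⟩
    have h1 := (X.affChart z₀ i).right_inv hy'
    have h2 : (X.affChart z₀ i).symm y ∈ X.affSource z₀ i := (X.affChart z₀ i).map_target hy'
    rw [affChart_coe] at h1
    refine ⟨?_, h1, h2⟩
    rw [← (X.chart z₀).left_inv h2.1]
    congr 1
    exact congrArg Prod.fst h1
  simp only [transSource, mfld_simps]
  constructor
  · rintro ⟨hy, h1, h2⟩
    obtain ⟨k1, k2, k3⟩ := key hy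
    rw [X.coord_trans k3 h1, k2] at h2
    refine ⟨⟨hy, k1 ▸ h1⟩, fun h => h2 (by simp [h])⟩
  · rintro ⟨⟨hy, h1⟩, h2⟩
    obtain ⟨k1, k2, k3⟩ := key hy
    rw [← k1] at h1
    refine ⟨hy, h1, ?_⟩
    rw [X.coord_trans k3 h1, k2]
    exact mul_ne_zero k3.2 h2

theorem affTrans_eq (z₀ z₁ : X.Z) (i i' : Fin (m + 1)) :
    Set.EqOn ((X.affChart z₀ i).symm.trans (X.affChart z₁ i'))
      (fun y => (X.trans z₀ z₁ y.1, fun j =>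
        X.transVec z₀ z₁ i y (i'.succAbove j) / X.transVec z₀ z₁ i y i'))
      ((X.affChart z₀ i).symm.trans (X.affChart z₁ i')).source := by
  intro y hy
  have hy' : y ∈ (X.affChart z₀ i).target := hy.1
  have hq' : (X.affChart z₀ i).symm y ∈ X.affSource z₁ i' := hy.2
  have hq : (X.affChart z₀ i).symm y ∈ X.affSource z₀ i := (X.affChart z₀ i).map_target hy'
  have h1 := (X.affChart z₀ i).right_inv hy'
  rw [affChart_coe] at h1
  have h2 := X.coord_trans hq hq'.1
  rw [h1] at h2
  refine Prod.ext ?_ ?_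
  · change X.chart z₁ ((X.affChart z₀ i).symm y).base = X.chart z₁ ((X.chart z₀).symm y.1)
    congr 1
    rw [← (X.chart z₀).left_inv hq.1]
    congr 1
    exact congrArg Prod.fst h1
  · ext j
    change X.coord z₁ ((X.affChart z₀ i).symm y) (i'.succAbove j) /
      X.coord z₁ ((X.affChart z₀ i).symm y) i' = _
    rw [h2]
    exact mul_div_mul_left _ _ hq.2

theorem affTrans_analytic (z₀ z₁ : X.Z) (i i' : Fin (m + 1)) :
    ContDiffOn ℂ ω ((X.affChart z₀ i).symm.trans (X.affChart z₁ i'))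
      ((X.affChart z₀ i).symm.trans (X.affChart z₁ i')).source := by
  refine ContDiffOn.congr ?_ (X.affTrans_eq z₀ z₁ i i')
  rw [affTrans_source]
  have h := contDiffOn_pi.1 ((X.transVec_analytic z₀ z₁ i).mono
    (Set.inter_subset_left (t := {y | X.transVec z₀ z₁ i y i' ≠ 0})))
  refine ContDiffOn.prodMk ?_ (contDiffOn_pi.2 fun j => (h _).div (h _) fun y hy => hy.2)
  exact (X.trans_analytic z₀ z₁).comp contDiffOn_fst fun y hy => hy.1.1

theorem isOpen_affTrans_source (z₀ z₁ : X.Z) (i i' : Fin (m + 1)) :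
    IsOpen ((X.affChart z₀ i).symm.trans (X.affChart z₁ i')).source := by
  rw [affTrans_source]
  have h := (continuous_apply i').comp_continuousOn (X.transVec_analytic z₀ z₁ i).continuousOn
  exact h.isOpen_inter_preimage ((X.isOpen_transSource z₀ z₁).prod isOpen_univ)
    (isOpen_compl_singleton (x := (0 : ℂ)))

/-- The atlas of `ℙD` formed by the affine charts. -/
def pdCore : ChartedSpaceCore (X.E × (Fin m → ℂ)) X.PD where
  atlas := {e | ∃ z₀ i, e = X.affChart z₀ i}
  chartAt q := X.affChart q.base (X.idx q)
  mem_chart_source q := X.mem_affSource q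
  chart_mem_atlas q := ⟨_, _, rfl⟩
  open_source := by
    rintro _ _ ⟨z₀, i, rfl⟩ ⟨z₁, i', rfl⟩
    exact X.isOpen_affTrans_source z₀ z₁ i i'
  continuousOn_toFun := by
    rintro _ _ ⟨z₀, i, rfl⟩ ⟨z₁, i', rfl⟩
    exact (X.affTrans_analytic z₀ z₁ i i').continuousOn

instance : TopologicalSpace X.PD := X.pdCore.toTopologicalSpace

instance : ChartedSpace (X.E × (Fin m → ℂ)) X.PD := X.pdCore.toChartedSpace

instance : IsManifold 𝓘(ℂ, X.E × (Fin m → ℂ)) ω X.PD := by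
  refine isManifold_of_contDiffOn _ _ _ ?_
  intro e e' he he'
  obtain ⟨_, ⟨f, rfl⟩, _, ⟨⟨z₀, i, rfl⟩, rfl⟩, he⟩ := he
  obtain ⟨_, ⟨f', rfl⟩, _, ⟨⟨z₁, i', rfl⟩, rfl⟩, he'⟩ := he'
  obtain rfl := Set.mem_singleton_iff.1 he
  obtain rfl := Set.mem_singleton_iff.1 he'
  simp only [mfld_simps]
  exact X.affTrans_analytic z₀ z₁ i i'

/-- The projection `π : ℙD → Z`. -/
def proj : X.PD → X.Z := PD.base

/-- The derivative `dπ` at `q` of the projection. -/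
def dproj (q : X.PD) : TangentSpace 𝓘(ℂ, X.E × (Fin m → ℂ)) q →L[ℂ]
    TangentSpace 𝓘(ℂ, X.E) q.base :=
  mfderiv 𝓘(ℂ, X.E × (Fin m → ℂ)) 𝓘(ℂ, X.E) X.proj q

/-- The prolonged distribution `D¹(z, ℓ) = dπ⁻¹(ℓ)`. -/
def prolongD (q : X.PD) :
    Submodule ℂ (TangentSpace 𝓘(ℂ, X.E × (Fin m → ℂ)) q) :=
  q.line.submodule.comap (X.dproj q).toLinearMap

/-- The frame of `D¹` in the affine chart at `q₀`: the vector `e = ∑ aⱼ eⱼ` spanning the line, and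
the coordinate vector fields along the fiber. -/
def prolongFrame (q₀ : X.PD) (j : Fin (m + 1)) (y : X.E × (Fin m → ℂ)) :
    X.E × (Fin m → ℂ) :=
  (Fin.cons (X.affVec q₀.base (X.idx q₀) y, 0) (fun k => (0, Pi.single k 1)) :
    Fin (m + 1) → X.E × (Fin m → ℂ)) j

/-- The dual coframe of `prolongFrame`. -/
def prolongCoframe (q₀ : X.PD) (y : X.E × (Fin m → ℂ)) :
    X.E × (Fin m → ℂ) →L[ℂ] (Fin (m + 1) → ℂ) :=
  ContinuousLinearMap.pi (Fin.cons
    (((ContinuousLinearMap.proj (R := ℂ) (φ := fun _ : Fin (m + 1) => ℂ) (X.idx q₀)).comp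
      (X.coframe q₀.base y.1)).comp (ContinuousLinearMap.fst ℂ X.E (Fin m → ℂ)))
    (fun k => (ContinuousLinearMap.proj (R := ℂ) (φ := fun _ : Fin m => ℂ) k).comp
      (ContinuousLinearMap.snd ℂ X.E (Fin m → ℂ))))

theorem chartAt_pd_coe (q₀ q : X.PD) :
    chartAt (X.E × (Fin m → ℂ)) q₀ q = X.affCoord q₀.base (X.idx q₀) q := rfl

theorem chartAt_pd_source (q₀ : X.PD) :
    (chartAt (X.E × (Fin m → ℂ)) q₀).source = X.affSource q₀.base (X.idx q₀) := rfl

theorem chartAt_pd_target (q₀ : X.PD) :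
    (chartAt (X.E × (Fin m → ℂ)) q₀).target = (X.chart q₀.base).target ×ˢ Set.univ := rfl

theorem mdifferentiableAt_proj (q : X.PD) :
    MDifferentiableAt 𝓘(ℂ, X.E × (Fin m → ℂ)) 𝓘(ℂ, X.E) X.proj q := by
  have hs := X.mem_affSource q
  have h1 : MDifferentiableAt 𝓘(ℂ, X.E × (Fin m → ℂ)) 𝓘(ℂ, X.E)
      ((X.chart q.base).symm ∘ Prod.fst ∘ chartAt (X.E × (Fin m → ℂ)) q) q := by
    refine MDifferentiableAt.comp (I' := 𝓘(ℂ, X.E)) q ?_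
      (MDifferentiableAt.comp (I' := 𝓘(ℂ, X.E × (Fin m → ℂ))) q ?_ ?_)
    · exact mdifferentiableAt_atlas_symm (chart_mem_atlas X.E _)
        ((X.chart q.base).map_source hs.1)
    · exact differentiableAt_fst.mdifferentiableAt
    · exact mdifferentiableAt_atlas (chart_mem_atlas _ _) hs
  refine h1.congr_of_eventuallyEq ?_
  filter_upwards [(chartAt (X.E × (Fin m → ℂ)) q).open_source.mem_nhds hs] with q' hq'
  exact ((X.chart q.base).left_inv hq'.1).symm

theorem dchart_proj {q₀ q : X.PD} (hq : q ∈ X.affSource q₀.base (X.idx q₀))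
    (v : TangentSpace 𝓘(ℂ, X.E × (Fin m → ℂ)) q) :
    X.dchart q₀.base q.base (X.dproj q v) =
      (mfderiv 𝓘(ℂ, X.E × (Fin m → ℂ)) 𝓘(ℂ, X.E × (Fin m → ℂ))
        (chartAt (X.E × (Fin m → ℂ)) q₀) q v : X.E × (Fin m → ℂ)).1 := by
  have h1 := mfderiv_comp (I := 𝓘(ℂ, X.E × (Fin m → ℂ))) (I' := 𝓘(ℂ, X.E))
    (I'' := 𝓘(ℂ, X.E)) q
    (mdifferentiableAt_atlas (I := 𝓘(ℂ, X.E)) (chart_mem_atlas X.E q₀.base) hq.1)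
    (X.mdifferentiableAt_proj q)
  have hc : MDifferentiableAt 𝓘(ℂ, X.E × (Fin m → ℂ)) 𝓘(ℂ, X.E × (Fin m → ℂ))
    (chartAt (X.E × (Fin m → ℂ)) q₀) q := mdifferentiableAt_atlas (chart_mem_atlas _ _) hq
  have h2 := mfderiv_comp (I := 𝓘(ℂ, X.E × (Fin m → ℂ)))
    (I' := 𝓘(ℂ, X.E × (Fin m → ℂ))) (I'' := 𝓘(ℂ, X.E)) q
    (differentiableAt_fst (𝕜 := ℂ) (E := X.E) (F := Fin m → ℂ)).mdifferentiableAt hc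
  have h3 : X.chart q₀.base ∘ X.proj = Prod.fst ∘ chartAt (X.E × (Fin m → ℂ)) q₀ := rfl
  erw [h3, h2, mfderiv_eq_fderiv, fderiv_fst] at h1
  exact (congrArg (fun f => f v) h1).symm

theorem prolongCoframe_apply (q₀ : X.PD) (y v : X.E × (Fin m → ℂ)) :
    X.prolongCoframe q₀ y v =
      Fin.cons (X.coframe q₀.base y.1 v.1 (X.idx q₀)) v.2 := by
  ext k
  refine Fin.cases ?_ (fun k => ?_) k <;> simp [prolongCoframe]

theorem prolongCoframe_analytic (q₀ : X.PD) :
    ContDiffOn ℂ ω (X.prolongCoframe q₀) ((X.chart q₀.base).target ×ˢ Set.univ) := by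
  let A : ℂ →L[ℂ] (Fin (m + 1) → ℂ) := ContinuousLinearMap.single ℂ (fun _ => ℂ) 0
  let B : (Fin m → ℂ) →L[ℂ] (Fin (m + 1) → ℂ) :=
    ContinuousLinearMap.pi (Fin.cons 0 fun k => ContinuousLinearMap.proj k)
  have h : X.prolongCoframe q₀ = fun y => (A.comp
      ((ContinuousLinearMap.proj (R := ℂ) (φ := fun _ : Fin (m + 1) => ℂ) (X.idx q₀)).comp
        ((X.coframe q₀.base y.1).comp (ContinuousLinearMap.fst ℂ X.E (Fin m → ℂ))))) +
      B.comp (ContinuousLinearMap.snd ℂ X.E (Fin m → ℂ)) := by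
    funext y
    refine ContinuousLinearMap.ext fun v => ?_
    rw [prolongCoframe_apply]
    ext k
    refine Fin.cases ?_ (fun k => ?_) k <;> simp [A, B]
  rw [h]
  refine ContDiffOn.add (contDiffOn_const.clm_comp (contDiffOn_const.clm_comp
    (ContDiffOn.clm_comp ?_ contDiffOn_const))) contDiffOn_const
  exact (X.coframe_analytic q₀.base).comp contDiffOn_fst fun y hy => hy.1

theorem prolong_map_D (q₀ q : X.PD) (hq : q ∈ X.affSource q₀.base (X.idx q₀)) :
    (X.prolongD q).map (mfderiv 𝓘(ℂ, X.E × (Fin m → ℂ)) 𝓘(ℂ, X.E × (Fin m → ℂ))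
        (chartAt (X.E × (Fin m → ℂ)) q₀) q).toLinearMap =
      Submodule.span ℂ (Set.range fun j =>
        X.prolongFrame q₀ j (chartAt (X.E × (Fin m → ℂ)) q₀ q)) := by
  have hrep := X.dchart_rep hq
  have hinj := (X.dchart_bijective hq.1).1
  have hbij : Function.Bijective (mfderiv 𝓘(ℂ, X.E × (Fin m → ℂ)) 𝓘(ℂ, X.E × (Fin m → ℂ))
        (chartAt (X.E × (Fin m → ℂ)) q₀) q) :=
    (mdifferentiable_chart (I := 𝓘(ℂ, X.E × (Fin m → ℂ))) q₀).mfderiv_bijective hq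
  rw [chartAt_pd_coe]
  have hspan : ∀ w : X.E × (Fin m → ℂ), w ∈ Submodule.span ℂ (Set.range fun j =>
      X.prolongFrame q₀ j (X.affCoord q₀.base (X.idx q₀) q)) ↔
      ∃ c : ℂ, c • X.affVec q₀.base (X.idx q₀) (X.affCoord q₀.base (X.idx q₀) q) = w.1 := by
    intro w
    rw [Submodule.mem_span_range_iff_exists_fun]
    constructor
    · rintro ⟨c, rfl⟩
      refine ⟨c 0, ?_⟩
      simp [Fin.sum_univ_succ, prolongFrame, Prod.fst_sum]
    · rintro ⟨c, hc⟩
      refine ⟨Fin.cons c w.2, ?_⟩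
      refine Prod.ext ?_ ?_
      · simp [Fin.sum_univ_succ, prolongFrame, Prod.fst_sum, hc]
      · ext k
        simp [Fin.sum_univ_succ, prolongFrame, Prod.snd_sum, Pi.single_apply]
  have hmem : ∀ v : TangentSpace 𝓘(ℂ, X.E × (Fin m → ℂ)) q, v ∈ X.prolongD q ↔
      ∃ c : ℂ, c • X.affVec q₀.base (X.idx q₀) (X.affCoord q₀.base (X.idx q₀) q) =
        (mfderiv 𝓘(ℂ, X.E × (Fin m → ℂ)) 𝓘(ℂ, X.E × (Fin m → ℂ))
          (chartAt (X.E × (Fin m → ℂ)) q₀) q v : X.E × (Fin m → ℂ)).1 := by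
    intro v
    rw [← X.dchart_proj hq v]
    change X.dproj q v ∈ q.line.submodule ↔ _
    rw [Projectivization.submodule_eq, Submodule.mem_span_singleton]
    generalize X.dproj q v = t
    constructor
    · rintro ⟨a, ha⟩
      refine ⟨a * X.coord q₀.base q (X.idx q₀), ?_⟩
      rw [mul_smul, ← hrep, ← map_smul]
      exact congrArg _ ha
    · rintro ⟨c, hc⟩
      refine ⟨c * (X.coord q₀.base q (X.idx q₀))⁻¹, hinj ?_⟩
      rw [map_smul, hrep, smul_smul, mul_assoc, inv_mul_cancel₀ hq.2, mul_one]
      exact hc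
  refine Submodule.ext fun (w : X.E × (Fin m → ℂ)) => ?_
  refine Iff.trans ?_ (hspan w).symm
  constructor
  · rintro ⟨v, hv, rfl⟩
    exact (hmem v).1 hv
  · rintro ⟨c, hc⟩
    obtain ⟨v, rfl⟩ := hbij.2 w
    exact ⟨v, (hmem v).2 ⟨c, hc⟩, rfl⟩

/-- The prolongation `(ℙD, D¹)` of `(Z, D)`. -/
def prolong : DistMfd m where
  E := X.E × (Fin m → ℂ)
  Z := X.PD
  D := X.prolongD
  frame := X.prolongFrame
  coframe := X.prolongCoframe
  frame_analytic q₀ j := by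
    rw [chartAt_pd_target]
    unfold prolongFrame
    refine Fin.cases ?_ (fun k => ?_) j
    · simpa using (X.affVec_analytic _ _).prodMk contDiffOn_const
    · simpa using contDiffOn_const
  coframe_analytic q₀ := X.prolongCoframe_analytic q₀
  coframe_frame q₀ y hy j := by
    have hy : y.1 ∈ (X.chart q₀.base).target := hy.1
    rw [prolongCoframe_apply]
    have h := X.coframe_sum hy (Fin.insertNth (X.idx q₀) 1 y.2 : Fin (m + 1) → ℂ)
    ext k
    refine Fin.cases ?_ (fun j => ?_) j <;> refine Fin.cases ?_ (fun k => ?_) k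
    · simp [prolongFrame, affVec, h]
    · simp [prolongFrame]
    · simp [prolongFrame]
    · simp [prolongFrame, Pi.single_apply]
  map_D := X.prolong_map_D

/-- `ℂ^{m+1}` with its tangent bundle as distribution. -/
def affineSpace (m : ℕ) : DistMfd m where
  E := Fin (m + 1) → ℂ
  Z := Fin (m + 1) → ℂ
  D _ := ⊤
  frame _ j _ := Pi.single j 1
  coframe _ _ := ContinuousLinearMap.id ℂ _
  frame_analytic _ _ := contDiffOn_const
  coframe_analytic _ := contDiffOn_const
  coframe_frame _ _ _ _ := rfl
  map_D z₀ z hz := by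
    have h := (mdifferentiable_chart (I := 𝓘(ℂ, Fin (m + 1) → ℂ)) z₀).mfderiv_bijective hz
    rw [Submodule.map_top, LinearMap.range_eq_top.2 h.2]
    symm
    refine Eq.trans ?_ (Pi.basisFun ℂ (Fin (m + 1))).span_eq
    congr 2
    funext j
    simp

/-! ### Submanifolds and their prolongations -/

/-- The tangent space at `z` of a submanifold `S` of a complex manifold `Z` modelled on `E`: the span
of the velocities at `0` of the holomorphic curve germs `γ : (ℂ, 0) → (Z, z)` lying in `S`. -/
def tangentTo (E : Type) {Z : Type} [NormedAddCommGroup E] [NormedSpace ℂ E] [TopologicalSpace Z]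
    [ChartedSpace E Z] (S : Set Z) (z : Z) : Submodule ℂ (TangentSpace 𝓘(ℂ, E) z) :=
  Submodule.span ℂ {v | ∃ γ : ℂ → Z, γ 0 = z ∧ (∀ᶠ t in 𝓝 (0 : ℂ), γ t ∈ S) ∧
    ContMDiffAt 𝓘(ℂ, ℂ) 𝓘(ℂ, E) ω γ 0 ∧
    (mfderiv 𝓘(ℂ, ℂ) 𝓘(ℂ, E) γ 0 (1 : ℂ) : E) = v}

/-- The distribution `D ∩ TS` induced on a submanifold `S ⊆ Z`. -/
def inducedD (S : Set X.Z) (z : X.Z) : Submodule ℂ (TangentSpace 𝓘(ℂ, X.E) z) :=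
  X.D z ⊓ tangentTo X.E S z

/-- The prolongation of a submanifold `S ⊆ Z` with its induced distribution: the set
`ℙ(D ∩ TS) ⊆ ℙD` of the `(z, ℓ)` with `z ∈ S` and `ℓ ⊆ D(z) ∩ T_z S`. -/
def prolongSet (S : Set X.Z) : Set X.PD :=
  {q | q.base ∈ S ∧ q.line.submodule ≤ X.inducedD S q.base}

end DistMfd

/-! ### The Monster tower and its critical hyperplanes -/

/-- The Monster tower for curves in `ℂⁿ`, `n = m + 1`: `monster m k` is `(𝒫ᵏ(n), Δₖ)`. -/
def monster (m : ℕ) : ℕ → DistMfd m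
  | 0 => DistMfd.affineSpace m
  | k + 1 => (monster m k).prolong

/-- Given `p ∈ 𝒫ᵏ(n)` with projections `p₀, …, p_k = p`, this is the stage at level `k` of the baby
Monster originating from level `i = k - j`, that is `𝒫ʲ(Fᵢ) ⊆ 𝒫ᵏ(n)`, where `Fᵢ` (`i ≥ 1`) is the
fiber of `𝒫ⁱ(n) → 𝒫ⁱ⁻¹(n)` through `pᵢ`. (It is empty when `j ≥ k`.) -/
def babyMonster (m : ℕ) : (k j : ℕ) → (monster m k).Z → Set (monster m k).Z
  | 0, _, _ => ∅
  | k + 1, 0, p => {q | (monster m k).proj q = (monster m k).proj p}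
  | k + 1, j + 1, p => (monster m k).prolongSet (babyMonster m k j ((monster m k).proj p))

/-- The `j` for which the baby Monster originating from level `k - j` passes through `p ∈ 𝒫ᵏ(n)`. -/
def criticalIndices (m k : ℕ) (p : (monster m k).Z) : Set ℕ :=
  {j | p ∈ babyMonster m k j p}

/-- For `j ∈ criticalIndices m k p`, the critical hyperplane
`δᵢʲ(p) = Δₖ(p) ∩ T_p 𝒫ʲ(Fᵢ)`, `i + j = k`, as a subspace of `Δₖ(p)`. -/
def criticalHyperplane (m k : ℕ) (p : (monster m k).Z) (j : ℕ) :
    Submodule ℂ ((monster m k).D p) :=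
  ((monster m k).inducedD (babyMonster m k j p) p).submoduleOf ((monster m k).D p)

/-- A family of hyperplanes in a vector space `V` is in general position if every subfamily of at
most `dim V` members has an intersection whose codimension is the number of members. -/
def HyperplanesInGeneralPosition {V ι : Type*} [AddCommGroup V] [Module ℂ V]
    (Λ : ι → Submodule ℂ V) : Prop :=
  (∀ i, IsCoatom (Λ i)) ∧
    ∀ J : Finset ι, J.card ≤ Module.finrank ℂ V →
      Module.finrank ℂ (V ⧸ ⨅ i ∈ J, Λ i) = J.card

end

/-! ### Hyperplane fields and their prolongation in affine coordinates. -/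

section Coordinates

variable {m : ℕ} {E : Type}

/-! A critical hyperplane is recorded by its covector in the frame of the distribution, and the
claim becomes that the covectors of the critical hyperplanes through one point are linearly
independent. In a space of dimension `m + 1` this bounds their number by `m + 1` and gives every
subfamily the right codimension.

Independence is proved by induction on the level. Let `S` carry a hyperplane field with covector
`a`. In affine coordinates `(x, u)`, where the line is spanned by the vector with coefficient `1` in
slot `i` and `u` elsewhere, the prolongation of `S` is cut out over `S` by the function `incidence a
i`. Its hyperplane is the kernel of the differential of that function on the prolonged distribution
(`IsHyperplaneEquation.lift`). In the prolonged frame, the vertical entries of the new covector are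
the entries of `a` other than the `i`-th; its entry `0` is a derivative about which nothing need be
known.

The hyperplanes one level up are the vertical one, with covector `Pi.single 0 1`, and the
prolongations of those old hyperplanes that contain the line. An old covector vanishing on the line
is determined by its entries outside slot `i`, so the vertical entries of the new covectors already
force independence, and `Pi.single 0 1`, whose vertical entries are zero, is independent of them
(`linearIndependent_prolonged`).

The analytic difficulty is that tangent spaces are spans of velocities of curves. Every vector of
the hyperplane is shown to be the velocity of an explicit curve; no submanifold structure on `S` is
used. -/

/-- The value of the covector field `a` on the vector with affine coordinates `y`. -/
noncomputable def incidence (a : E → Fin (m + 1) → ℂ) (i : Fin (m + 1)) (y : E × (Fin m → ℂ)) : ℂ :=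
  a y.1 ⬝ᵥ (i.insertNth 1 y.2 : Fin (m + 1) → ℂ)

theorem incidence_eq (a : E → Fin (m + 1) → ℂ) (i : Fin (m + 1)) (y : E × (Fin m → ℂ)) :
    incidence a i y = a y.1 i + ∑ k, a y.1 (i.succAbove k) * y.2 k := by
  simp [incidence, dotProduct, Fin.sum_univ_succAbove _ i]

theorem incidence_add (a : E → Fin (m + 1) → ℂ) (i : Fin (m + 1)) (x : E) (u w : Fin m → ℂ) :
    incidence a i (x, u + w) = incidence a i (x, u) + ∑ k, a x (i.succAbove k) * w k := by
  simp [incidence_eq, mul_add, Finset.sum_add_distrib, add_assoc]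

variable [NormedAddCommGroup E] [NormedSpace ℂ E]

/-- The velocities at `0` of the analytic curve germs through `x` that lie in `S`. -/
def velocities (S : Set E) (x : E) : Set E :=
  {w | ∃ c : ℂ → E, c 0 = x ∧ (∀ᶠ t in 𝓝 (0 : ℂ), c t ∈ S) ∧ ContDiffAt ℂ ω c 0 ∧
    deriv c 0 = w}

/-- `a` is, over `S ∩ U`, an analytic equation (in the frame `F`) for the hyperplane field cut out by
the tangent spaces of `S`, and every vector of that field is the velocity of a curve in `S`. -/
structure IsHyperplaneEquation (F : Fin (m + 1) → E → E) (S U : Set E)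
    (a : E → Fin (m + 1) → ℂ) : Prop where
  isOpen : IsOpen U
  analytic : ContDiffOn ℂ ω a U
  ne_zero : ∀ x ∈ U, x ∈ S → a x ≠ 0
  eq_zero : ∀ x ∈ U, x ∈ S → ∀ b : Fin (m + 1) → ℂ,
    ∑ j, b j • F j x ∈ Submodule.span ℂ (velocities S x) → a x ⬝ᵥ b = 0
  mem_velocities : ∀ x ∈ U, x ∈ S → ∀ b : Fin (m + 1) → ℂ,
    a x ⬝ᵥ b = 0 → ∑ j, b j • F j x ∈ velocities S x

theorem IsHyperplaneEquation.mem_span_iff {F : Fin (m + 1) → E → E} {S U : Set E}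
    {a : E → Fin (m + 1) → ℂ} (h : IsHyperplaneEquation F S U a) {x : E} (hU : x ∈ U)
    (hS : x ∈ S) (b : Fin (m + 1) → ℂ) :
    ∑ j, b j • F j x ∈ Submodule.span ℂ (velocities S x) ↔ a x ⬝ᵥ b = 0 :=
  ⟨h.eq_zero x hU hS b, fun hb => Submodule.subset_span (h.mem_velocities x hU hS b hb)⟩

/-- `∑ aⱼ Fⱼ(x)` with `aᵢ = 1` and the other coefficients given by `u`. -/
noncomputable def affineVector (F : Fin (m + 1) → E → E) (i : Fin (m + 1)) (y : E × (Fin m → ℂ)) : E :=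
  ∑ j, (i.insertNth 1 y.2 : Fin (m + 1) → ℂ) j • F j y.1

/-- The frame of the prolonged distribution in affine coordinates. -/
noncomputable def liftFrame (F : Fin (m + 1) → E → E) (i : Fin (m + 1)) (j : Fin (m + 1))
    (y : E × (Fin m → ℂ)) : E × (Fin m → ℂ) :=
  (Fin.cons (affineVector F i y, 0) (fun k => (0, Pi.single k 1)) :
    Fin (m + 1) → E × (Fin m → ℂ)) j

/-- The equation of the prolonged hyperplane field: the derivative of `incidence a i` in the
frame `liftFrame F i`. -/
noncomputable def liftEquation (F : Fin (m + 1) → E → E) (a : E → Fin (m + 1) → ℂ) (i : Fin (m + 1))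
    (y : E × (Fin m → ℂ)) : Fin (m + 1) → ℂ :=
  Fin.cons (fderiv ℂ (incidence a i) y (affineVector F i y, 0))
    (fun k => a y.1 (i.succAbove k))

theorem sum_smul_liftFrame (F : Fin (m + 1) → E → E) (i : Fin (m + 1)) (y : E × (Fin m → ℂ))
    (b : Fin (m + 1) → ℂ) :
    ∑ j, b j • liftFrame F i j y = (b 0 • affineVector F i y, Fin.tail b) := by
  refine Prod.ext ?_ ?_
  · simp [Fin.sum_univ_succ, liftFrame, Prod.fst_sum]
  · ext k
    simp [Fin.sum_univ_succ, liftFrame, Prod.snd_sum, Pi.single_apply, Fin.tail]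

theorem analytic_affineVector {F : Fin (m + 1) → E → E} {U : Set E}
    (hF : ∀ j, ContDiffOn ℂ ω (F j) U) (i : Fin (m + 1)) :
    ContDiffOn ℂ ω (affineVector F i) (U ×ˢ Set.univ) := by
  unfold affineVector
  refine ContDiffOn.sum fun j _ => ContDiffOn.smul ?_ ?_
  · refine Fin.succAboveCases i ?_ (fun k => ?_) j
    · simpa using contDiffOn_const
    · simp only [Fin.insertNth_apply_succAbove]
      fun_prop
  · exact (hF j).comp contDiffOn_fst fun y hy => hy.1

theorem analytic_incidence {a : E → Fin (m + 1) → ℂ} {U : Set E} (ha : ContDiffOn ℂ ω a U)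
    (i : Fin (m + 1)) : ContDiffOn ℂ ω (incidence a i) (U ×ˢ Set.univ) := by
  have h : incidence a i = fun y => a y.1 i + ∑ k, a y.1 (i.succAbove k) * y.2 k :=
    funext (incidence_eq a i)
  rw [h]
  have ha' : ∀ j, ContDiffOn ℂ ω (fun y : E × (Fin m → ℂ) => a y.1 j) (U ×ˢ Set.univ) :=
    fun j => (contDiffOn_pi.1 ha j).comp contDiffOn_fst fun y hy => hy.1
  refine (ha' i).add (ContDiffOn.sum fun k _ => (ha' _).mul ?_)
  fun_prop

theorem differentiableAt_incidence {a : E → Fin (m + 1) → ℂ} {U : Set E} (hU : IsOpen U)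
    (ha : ContDiffOn ℂ ω a U) (i : Fin (m + 1)) {y : E × (Fin m → ℂ)} (hy : y.1 ∈ U) :
    DifferentiableAt ℂ (incidence a i) y :=
  ((analytic_incidence ha i).differentiableOn (by simp)).differentiableAt
    ((hU.prod isOpen_univ).mem_nhds ⟨hy, trivial⟩)

/-- Over a fixed `x`, `incidence a i` is affine in `u`, so its derivative along the fiber is its
linear part. -/
theorem fderiv_incidence_vertical {a : E → Fin (m + 1) → ℂ} {U : Set E} (hU : IsOpen U)
    (ha : ContDiffOn ℂ ω a U) (i : Fin (m + 1)) {y : E × (Fin m → ℂ)} (hy : y.1 ∈ U)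
    (w : Fin m → ℂ) :
    fderiv ℂ (incidence a i) y (0, w) = ∑ k, a y.1 (i.succAbove k) * w k := by
  obtain ⟨x, u⟩ := y
  have h1 : HasDerivAt (fun t : ℂ => ((x, u + t • w) : E × (Fin m → ℂ))) (0, w) 0 := by
    refine (hasDerivAt_const (0 : ℂ) x).prodMk ?_
    simpa using ((hasDerivAt_id (0 : ℂ)).smul_const w).const_add u
  have hd := (differentiableAt_incidence hU ha i hy).hasFDerivAt
  have h2 : HasDerivAt (fun t : ℂ => incidence a i (x, u + t • w))
      (fderiv ℂ (incidence a i) (x, u) (0, w)) 0 := by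
    have hd' : HasFDerivAt (incidence a i) (fderiv ℂ (incidence a i) (x, u))
      (x, u + (0 : ℂ) • w) := by simpa using hd
    exact hd'.comp_hasDerivAt (0 : ℂ) h1
  have h3 : HasDerivAt (fun t : ℂ => incidence a i (x, u + t • w))
      (∑ k, a x (i.succAbove k) * w k) 0 := by
    have : (fun t : ℂ => incidence a i (x, u + t • w)) =
        fun t => incidence a i (x, u) + t * ∑ k, a x (i.succAbove k) * w k := by
      funext t
      rw [incidence_add, Finset.mul_sum]
      congr 1
      refine Finset.sum_congr rfl fun k _ => ?_
      simp only [Pi.smul_apply, smul_eq_mul]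
      ring
    rw [this]
    simpa using ((hasDerivAt_id (0 : ℂ)).mul_const (∑ k, a x (i.succAbove k) * w k)).const_add
      (incidence a i (x, u))
  exact h2.unique h3

/-- Splitting the vector into its part along the line and its vertical part gives the two kinds of
entries of `liftEquation`. -/
theorem liftEquation_dotProduct {F : Fin (m + 1) → E → E} {a : E → Fin (m + 1) → ℂ} {U : Set E}
    (hU : IsOpen U) (ha : ContDiffOn ℂ ω a U) (i : Fin (m + 1)) {y : E × (Fin m → ℂ)}
    (hy : y.1 ∈ U) (b : Fin (m + 1) → ℂ) :
    liftEquation F a i y ⬝ᵥ b = fderiv ℂ (incidence a i) y (∑ j, b j • liftFrame F i j y) := by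
  have h : ((b 0 • affineVector F i y, Fin.tail b) : E × (Fin m → ℂ)) =
      b 0 • (affineVector F i y, 0) + (0, Fin.tail b) := by simp
  rw [sum_smul_liftFrame, h, map_add, map_smul, fderiv_incidence_vertical hU ha i hy]
  simp [liftEquation, dotProduct, Fin.sum_univ_succ, Fin.tail, mul_comm]

/-- If all other entries vanished, the pairing would reduce to `v i`. Consequently `incidence a i`
has nonzero vertical derivative at its zeros over `S`: the lifted covector is nonzero, and the
equation can be solved for one fiber coordinate. -/
theorem exists_succAbove_ne_zero {v : Fin (m + 1) → ℂ} {i : Fin (m + 1)} {u : Fin m → ℂ}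
    (hv : v ≠ 0) (h : v ⬝ᵥ (i.insertNth 1 u : Fin (m + 1) → ℂ) = 0) :
    ∃ k, v (i.succAbove k) ≠ 0 := by
  by_contra! hk
  have hi : v i = 0 := by simpa [dotProduct, Fin.sum_univ_succAbove _ i, hk] using h
  refine hv (funext fun j => ?_)
  exact Fin.succAboveCases i hi hk j

/-- The hyperplane field of a submanifold of the projectivization that consists of the lines tangent
to `S` has the equation `liftEquation F a i`. -/
theorem IsHyperplaneEquation.lift {F : Fin (m + 1) → E → E} {S U : Set E}
    {a : E → Fin (m + 1) → ℂ} (h : IsHyperplaneEquation F S U a)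
    (hF : ∀ j, ContDiffOn ℂ ω (F j) U) (i : Fin (m + 1)) {S' : Set (E × (Fin m → ℂ))}
    (hS' : ∀ y : E × (Fin m → ℂ), y.1 ∈ U → (y ∈ S' ↔
      y.1 ∈ S ∧ affineVector F i y ∈ Submodule.span ℂ (velocities S y.1))) :
    IsHyperplaneEquation (liftFrame F i) S' (U ×ˢ Set.univ) (liftEquation F a i) := by
  have hmem : ∀ y : E × (Fin m → ℂ), y.1 ∈ U → (y ∈ S' ↔ y.1 ∈ S ∧ incidence a i y = 0) := by
    intro y hy
    rw [hS' y hy]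
    exact and_congr_right fun hs => h.mem_span_iff hy hs _
  have hopen : IsOpen (U ×ˢ (Set.univ : Set (Fin m → ℂ))) := h.isOpen.prod isOpen_univ
  have hA := analytic_incidence h.analytic i
  refine ⟨hopen, ?_, ?_, ?_, ?_⟩
  · refine contDiffOn_pi.2 fun j => ?_
    unfold liftEquation
    refine Fin.cases ?_ (fun k => ?_) j
    · simp only [Fin.cons_zero]
      exact (hA.fderiv_of_isOpen hopen le_rfl).clm_apply
        ((analytic_affineVector hF i).prodMk contDiffOn_const)
    · simp only [Fin.cons_succ]
      exact (contDiffOn_pi.1 h.analytic _).comp contDiffOn_fst fun y hy => hy.1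
  · rintro y ⟨hy, -⟩ hs h0
    obtain ⟨hs, hi⟩ := (hmem y hy).1 hs
    obtain ⟨k, hk⟩ := exists_succAbove_ne_zero (h.ne_zero _ hy hs) hi
    exact hk (by simpa [liftEquation] using congrFun h0 k.succ)
  · rintro y ⟨hy, -⟩ hs b hb
    rw [liftEquation_dotProduct h.isOpen h.analytic i hy]
    -- `incidence a i` vanishes along every curve in `S'`, so its differential kills all velocities,
    -- hence their span.
    have hle : Submodule.span ℂ (velocities S' y) ≤
        LinearMap.ker (fderiv ℂ (incidence a i) y).toLinearMap := by
      rw [Submodule.span_le]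
      rintro _ ⟨c, rfl, hcS, hc, rfl⟩
      have hd := hc.differentiableAt (by simp)
      have h1 := (differentiableAt_incidence h.isOpen h.analytic i hy).hasFDerivAt.comp_hasDerivAt
        (0 : ℂ) hd.hasDerivAt
      have h2 : incidence a i ∘ c =ᶠ[𝓝 0] fun _ => 0 := by
        filter_upwards [hcS, hd.continuousAt.preimage_mem_nhds (hopen.mem_nhds ⟨hy, trivial⟩)]
          with t ht ht'
        exact ((hmem _ ht'.1).1 ht).2
      exact (h1.congr_of_eventuallyEq h2.symm).unique (hasDerivAt_const _ _)
    exact hle hb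
  · rintro ⟨x, u⟩ ⟨hy, -⟩ hs b hb
    replace hy : x ∈ U := hy
    rw [liftEquation_dotProduct h.isOpen h.analytic i hy] at hb
    rw [sum_smul_liftFrame] at hb ⊢
    obtain ⟨hs, hi⟩ := (hmem _ hy).1 hs
    replace hs : x ∈ S := hs
    obtain ⟨k, hk⟩ := exists_succAbove_ne_zero (h.ne_zero _ hy hs) hi
    replace hk : a x (i.succAbove k) ≠ 0 := hk
    -- The base component `b 0 • affineVector F i (x, u)` lies in the hyperplane of `S`, because the
    -- incidence is zero. It must be the velocity of a single curve, which is why `mem_velocities`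
    -- is stated without a span.
    obtain ⟨σ, rfl, hσS, hσ, hσd⟩ := h.mem_velocities x hy hs
      (b 0 • (i.insertNth 1 u : Fin (m + 1) → ℂ)) (by
        rw [dotProduct_smul]
        exact smul_eq_zero_of_right _ hi)
    have hσd : deriv σ 0 = b 0 • affineVector F i (σ 0, u) := by
      rw [hσd, affineVector, Finset.smul_sum]
      simp [mul_smul]
    set w : Fin m → ℂ := Fin.tail b with hw
    have hσdiff := hσ.differentiableAt (by simp)
    have hσU : ∀ᶠ t in 𝓝 (0 : ℂ), σ t ∈ U :=
      hσdiff.continuousAt.preimage_mem_nhds (h.isOpen.mem_nhds hy)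
    have haσ : ContDiffAt ℂ ω (fun t => a (σ t) (i.succAbove k)) 0 :=
      ((contDiffOn_pi.1 h.analytic (i.succAbove k)).contDiffAt (h.isOpen.mem_nhds hy)).comp 0 hσ
    have hline : ContDiffAt ℂ ω (fun t : ℂ => ((σ t, u + t • w) : E × (Fin m → ℂ))) 0 :=
      hσ.prodMk (contDiffAt_const.add (contDiffAt_id.smul contDiffAt_const))
    have hg : ContDiffAt ℂ ω (fun t : ℂ => incidence a i (σ t, u + t • w)) 0 := by
      refine ContDiffAt.comp (g := incidence a i)
        (f := fun t : ℂ => ((σ t, u + t • w) : E × (Fin m → ℂ))) (0 : ℂ) ?_ hline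
      exact hA.contDiffAt (hopen.mem_nhds ⟨hy, trivial⟩)
    have hlined : HasDerivAt (fun t : ℂ => ((σ t, u + t • w) : E × (Fin m → ℂ)))
        (b 0 • affineVector F i (σ 0, u), w) 0 := by
      refine (hσd ▸ hσdiff.hasDerivAt).prodMk ?_
      simpa using ((hasDerivAt_id (0 : ℂ)).smul_const w).const_add u
    -- The uncorrected curve `(σ t, u + t • w)` has the desired velocity, and satisfies the
    -- incidence equation to first order by `hb`.
    have hgd : HasDerivAt (fun t : ℂ => incidence a i (σ t, u + t • w)) 0 0 := by
      have hd' : HasFDerivAt (incidence a i) (fderiv ℂ (incidence a i) (σ 0, u))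
        (σ 0, u + (0 : ℂ) • w) := by
          simpa using (differentiableAt_incidence h.isOpen h.analytic i
            (y := (σ 0, u)) hy).hasFDerivAt
      have h1 := hd'.comp_hasDerivAt (0 : ℂ) hlined
      rwa [hb] at h1
    have hg0 : incidence a i (σ 0, u + (0 : ℂ) • w) = 0 := by simpa using hi
    -- Moving the `k`-th fiber coordinate changes the incidence at rate `a (σ t) (i.succAbove k)`,
    -- so subtracting this quotient makes the incidence exactly zero.
    refine ⟨fun t => (σ t, u + t • w -
      (incidence a i (σ t, u + t • w) / a (σ t) (i.succAbove k)) • Pi.single k (1 : ℂ)),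
      ?_, ?_, ?_, ?_⟩
    · simp only [hg0]
      simp
    · have hne : ∀ᶠ t in 𝓝 (0 : ℂ), a (σ t) (i.succAbove k) ≠ 0 :=
        haσ.continuousAt.eventually_ne hk
      filter_upwards [hσU, hσS, hne] with t h1 h2 h3
      refine (hmem _ h1).2 ⟨h2, ?_⟩
      rw [sub_eq_add_neg, incidence_add]
      simp [Pi.single_apply, mul_div_cancel₀ _ h3]
    · exact hσ.prodMk ((contDiffAt_const.add (contDiffAt_id.smul contDiffAt_const)).sub
        ((hg.div haσ hk).smul contDiffAt_const))
    · refine HasDerivAt.deriv ?_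
      -- The numerator vanishes at `0` together with its derivative, so the correction does not
      -- alter the velocity.
      have hq := hgd.div (haσ.differentiableAt (by simp)).hasDerivAt hk
      rw [hg0] at hq
      refine (hσd ▸ hσdiff.hasDerivAt).prodMk ?_
      have h1 : HasDerivAt (fun t : ℂ => u + t • w) w 0 := by
        simpa using ((hasDerivAt_id (0 : ℂ)).smul_const w).const_add u
      have h2 := h1.sub (hq.smul_const (Pi.single k (1 : ℂ) : Fin m → ℂ))
      simp only [zero_mul, sub_zero, zero_div, zero_smul] at h2
      exact h2

/-- The vertical hyperplane field of a fiber. -/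
theorem isHyperplaneEquation_fiber (F : Fin (m + 1) → E → E) (i : Fin (m + 1)) (x₀ : E)
    {U : Set E} (hU : IsOpen U) {S' : Set (E × (Fin m → ℂ))}
    (hne : ∀ y : E × (Fin m → ℂ), y.1 ∈ U → affineVector F i y ≠ 0)
    (hS' : ∀ y : E × (Fin m → ℂ), y.1 ∈ U → (y ∈ S' ↔ y.1 = x₀)) :
    IsHyperplaneEquation (liftFrame F i) S' (U ×ˢ Set.univ) (fun _ => Pi.single 0 1) := by
  have hopen : IsOpen (U ×ˢ (Set.univ : Set (Fin m → ℂ))) := hU.prod isOpen_univ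
  refine ⟨hopen, contDiffOn_const, fun _ _ _ h => by simpa using congrFun h 0, ?_, ?_⟩
  · rintro y ⟨hy, -⟩ hs b hb
    rw [sum_smul_liftFrame] at hb
    -- Curves in the fiber have constant base component.
    have hle : Submodule.span ℂ (velocities S' y) ≤
        LinearMap.ker (LinearMap.fst ℂ E (Fin m → ℂ)) := by
      rw [Submodule.span_le]
      rintro _ ⟨c, rfl, hcS, hc, rfl⟩
      have hd := hc.differentiableAt (by simp)
      have h1 := (hasFDerivAt_fst (𝕜 := ℂ) (p := c 0)).comp_hasDerivAt (0 : ℂ) hd.hasDerivAt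
      have h2 : Prod.fst ∘ c =ᶠ[𝓝 0] fun _ => x₀ := by
        filter_upwards [hcS, hd.continuousAt.preimage_mem_nhds (hopen.mem_nhds ⟨hy, trivial⟩)]
          with t ht ht'
        exact (hS' _ ht'.1).1 ht
      exact (h1.congr_of_eventuallyEq h2.symm).unique (hasDerivAt_const _ _)
    have h0 : b 0 • affineVector F i y = 0 := hle hb
    simpa using (smul_eq_zero.1 h0).resolve_right (hne y hy)
  · rintro ⟨x, u⟩ ⟨hy, -⟩ hs b hb
    have hx : x = x₀ := (hS' _ hy).1 hs
    have hb : b 0 = 0 := by simpa using hb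
    rw [sum_smul_liftFrame, hb, zero_smul]
    refine ⟨fun t => (x, u + t • Fin.tail b), by simp, ?_, ?_, ?_⟩
    · exact Filter.Eventually.of_forall fun t => (hS' (x, u + t • Fin.tail b) hy).2 hx
    · exact contDiffAt_const.prodMk (contDiffAt_const.add (contDiffAt_id.smul contDiffAt_const))
    · refine HasDerivAt.deriv ((hasDerivAt_const (0 : ℂ) x).prodMk ?_)
      simpa using ((hasDerivAt_id (0 : ℂ)).smul_const (Fin.tail b)).const_add u

/-! ### Linear algebra of the prolonged covectors. -/

/-- Linear independence is inherited by the equations of the prolonged hyperplanes together with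
that of the vertical one. -/
theorem linearIndependent_prolonged {ι : Type*} {v : ι → Fin (m + 1) → ℂ}
    (hv : LinearIndependent ℂ v) {i : Fin (m + 1)} {u : Fin m → ℂ}
    (hi : ∀ s, v s ⬝ᵥ (i.insertNth 1 u : Fin (m + 1) → ℂ) = 0)
    {v' : Option ι → Fin (m + 1) → ℂ} (h0 : v' none = Pi.single 0 1)
    (hs : ∀ s k, v' (some s) (Fin.succ k) = v s (i.succAbove k)) : LinearIndependent ℂ v' := by
  -- `R` rebuilds an old covector from the new one: it copies the vertical entries and solves the
  -- incidence relation for slot `i`. It ignores entry `0`, so it kills `Pi.single 0 1`.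
  let R : (Fin (m + 1) → ℂ) →ₗ[ℂ] (Fin (m + 1) → ℂ) :=
    LinearMap.pi fun j => Fin.succAboveCases i
      (-∑ k, u k • LinearMap.proj (R := ℂ) (φ := fun _ : Fin (m + 1) => ℂ) (Fin.succ k))
      (fun k => LinearMap.proj (Fin.succ k)) j
  have hR : ∀ s, R (v' (some s)) = v s := by
    intro s
    ext j
    have hi := hi s
    simp only [dotProduct, Fin.sum_univ_succAbove _ i, Fin.insertNth_apply_same, mul_one,
      Fin.insertNth_apply_succAbove] at hi
    refine Fin.succAboveCases i ?_ (fun k => ?_) j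
    · simp [R, hs, mul_comm, eq_neg_of_add_eq_zero_left hi]
    · simp [R, hs]
  have hR0 : R (v' none) = 0 := by
    ext j
    refine Fin.succAboveCases i ?_ (fun k => ?_) j <;> simp [R, h0]
  rw [linearIndependent_option]
  have hcomp : (R : _ → _) ∘ (v' ∘ some) = v := funext hR
  refine ⟨LinearIndependent.of_comp R (by rwa [hcomp]), fun hspan => ?_⟩
  -- Applying `R` to such a combination gives a relation among the old covectors, so `c = 0` and the
  -- vertical covector would be zero.
  obtain ⟨c, hc⟩ := Finsupp.mem_span_range_iff_exists_finsupp.1 hspan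
  have h1 := congrArg R hc
  rw [hR0, map_finsuppSum] at h1
  simp only [Function.comp_apply, map_smul, hR] at h1
  rw [linearIndependent_iff.1 hv c h1, Finsupp.sum_zero_index, h0] at hc
  simpa using congrFun hc 0

end Coordinates

/-! ### Transfer from coordinates to the manifolds of the tower. -/

namespace DistMfd

section Charts

variable {m : ℕ} (X : DistMfd m)

/-- The image of `S` in the chart at `z₀`. -/
def chartSet (z₀ : X.Z) (S : Set X.Z) : Set X.E :=
  {x | x ∈ (X.chart z₀).target ∧ (X.chart z₀).symm x ∈ S}

theorem chart_mem_chartSet {z₀ z : X.Z} (hz : z ∈ (X.chart z₀).source) {S : Set X.Z} :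
    X.chart z₀ z ∈ X.chartSet z₀ S ↔ z ∈ S := by
  simp [chartSet, (X.chart z₀).map_source hz, (X.chart z₀).left_inv hz]

/-- Composing with the chart or its inverse exchanges analytic curve germs in `S` with those in its
image; the chain rule matches the velocities. -/
theorem velocities_chartSet {z₀ z : X.Z} (hz : z ∈ (X.chart z₀).source) (S : Set X.Z) :
    velocities (X.chartSet z₀ S) (X.chart z₀ z) = X.dchart z₀ z ''
      {v | ∃ γ : ℂ → X.Z, γ 0 = z ∧ (∀ᶠ t in 𝓝 (0 : ℂ), γ t ∈ S) ∧
        ContMDiffAt 𝓘(ℂ, ℂ) 𝓘(ℂ, X.E) ω γ 0 ∧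
        (mfderiv 𝓘(ℂ, ℂ) 𝓘(ℂ, X.E) γ 0 (1 : ℂ) : X.E) = v} := by
  have key : ∀ γ : ℂ → X.Z, γ 0 = z → ContMDiffAt 𝓘(ℂ, ℂ) 𝓘(ℂ, X.E) ω γ 0 →
      ContDiffAt ℂ ω (X.chart z₀ ∘ γ) 0 ∧ deriv (X.chart z₀ ∘ γ) 0 =
        X.dchart z₀ (γ 0) (mfderiv 𝓘(ℂ, ℂ) 𝓘(ℂ, X.E) γ 0 (1 : ℂ)) := by
    rintro γ rfl hγ
    have hc : ContMDiffAt 𝓘(ℂ, X.E) 𝓘(ℂ, X.E) ω (X.chart z₀) (γ 0) :=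
      (contMDiffOn_chart (I := 𝓘(ℂ, X.E)) (n := ω) (x := z₀)).contMDiffAt
        ((X.chart z₀).open_source.mem_nhds hz)
    refine ⟨(hc.comp (0 : ℂ) hγ).contDiffAt, ?_⟩
    have h := mfderiv_comp (0 : ℂ) (hc.mdifferentiableAt (by simp))
      (hγ.mdifferentiableAt (by simp))
    rw [mfderiv_eq_fderiv] at h
    rw [← fderiv_apply_one_eq_deriv]
    exact congrArg (fun f => f (1 : ℂ)) h
  ext w
  constructor
  · rintro ⟨c, hc0, hcS, hc, rfl⟩
    have hx : c 0 ∈ (X.chart z₀).target := hc0 ▸ (X.chart z₀).map_source hz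
    have hγ0 : ((X.chart z₀).symm ∘ c) 0 = z := by
      simp [hc0, (X.chart z₀).left_inv hz]
    have hγ : ContMDiffAt 𝓘(ℂ, ℂ) 𝓘(ℂ, X.E) ω ((X.chart z₀).symm ∘ c) 0 :=
      ((contMDiffOn_chart_symm (I := 𝓘(ℂ, X.E)) (n := ω) (x := z₀)).contMDiffAt
        ((X.chart z₀).open_target.mem_nhds hx)).comp (0 : ℂ) hc.contMDiffAt
    have hcc : X.chart z₀ ∘ (X.chart z₀).symm ∘ c =ᶠ[𝓝 0] c := by
      filter_upwards [hcS] with t ht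
      exact (X.chart z₀).right_inv ht.1
    refine ⟨_, ⟨(X.chart z₀).symm ∘ c, hγ0, ?_, hγ, rfl⟩, ?_⟩
    · filter_upwards [hcS] with t ht
      exact ht.2
    · rw [← hcc.deriv_eq, (key _ hγ0 hγ).2]
      exact congrArg (fun y => X.dchart z₀ y
        (mfderiv 𝓘(ℂ, ℂ) 𝓘(ℂ, X.E) ((X.chart z₀).symm ∘ c) 0 (1 : ℂ) : X.E)) hγ0.symm
  · rintro ⟨_, ⟨γ, rfl, hγS, hγ, rfl⟩, rfl⟩
    obtain ⟨h1, h2⟩ := key γ rfl hγ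
    refine ⟨X.chart z₀ ∘ γ, rfl, ?_, h1, h2⟩
    filter_upwards [hγS, hγ.continuousAt.preimage_mem_nhds
      ((X.chart z₀).open_source.mem_nhds hz)] with t ht ht'
    exact (X.chart_mem_chartSet ht').2 ht

theorem mem_tangentTo_iff {z₀ z : X.Z} (hz : z ∈ (X.chart z₀).source) (S : Set X.Z)
    (v : TangentSpace 𝓘(ℂ, X.E) z) :
    v ∈ tangentTo X.E S z ↔
      X.dchart z₀ z v ∈ Submodule.span ℂ (velocities (X.chartSet z₀ S) (X.chart z₀ z)) := by
  rw [X.velocities_chartSet hz S]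
  have h := Submodule.map_span (X.dchart z₀ z).toLinearMap
    {v | ∃ γ : ℂ → X.Z, γ 0 = z ∧ (∀ᶠ t in 𝓝 (0 : ℂ), γ t ∈ S) ∧
        ContMDiffAt 𝓘(ℂ, ℂ) 𝓘(ℂ, X.E) ω γ 0 ∧
        (mfderiv 𝓘(ℂ, ℂ) 𝓘(ℂ, X.E) γ 0 (1 : ℂ) : X.E) = v}
  constructor
  · intro hv
    exact h.le (Submodule.mem_map_of_mem hv)
  · intro hv
    obtain ⟨v', hv', e⟩ := h.ge hv
    exact (X.dchart_bijective hz).1 e ▸ hv'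

/-- `a` is an equation, near `z₀` and in the chart at `z₀`, for the distribution induced on `S`. -/
def HasEquationAt (S : Set X.Z) (z₀ : X.Z) (a : X.E → Fin (m + 1) → ℂ) : Prop :=
  ∃ U ⊆ (X.chart z₀).target, X.chart z₀ z₀ ∈ U ∧
    IsHyperplaneEquation (X.frame z₀) (X.chartSet z₀ S) U a

variable {X}

theorem HasEquationAt.mem_inducedD_iff {S : Set X.Z} {z : X.Z} {a : X.E → Fin (m + 1) → ℂ}
    (h : X.HasEquationAt S z a) (hS : z ∈ S) {v : TangentSpace 𝓘(ℂ, X.E) z} (hv : v ∈ X.D z) :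
    v ∈ X.inducedD S z ↔
      a (X.chart z z) ⬝ᵥ X.coframe z (X.chart z z) (X.dchart z z v) = 0 := by
  obtain ⟨U, -, hz, h⟩ := h
  have hs : z ∈ (X.chart z).source := mem_chart_source X.E z
  rw [← h.mem_span_iff hz ((X.chart_mem_chartSet hs).2 hS), ← X.dchart_eq_sum hs hv,
    ← X.mem_tangentTo_iff hs]
  exact ⟨fun h => h.2, fun h => ⟨hv, h⟩⟩

/-- In the chart, the chosen spanning vector of the line is a nonzero multiple of the affine vector.
-/
theorem mem_prolongSet_iff {S : Set X.Z} {z₀ : X.Z} {i : Fin (m + 1)} {q : X.PD}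
    (hq : q ∈ X.affSource z₀ i) :
    q ∈ X.prolongSet S ↔ q.base ∈ S ∧ affineVector (X.frame z₀) i (X.affCoord z₀ i q) ∈
      Submodule.span ℂ (velocities (X.chartSet z₀ S) (X.chart z₀ q.base)) := by
  refine and_congr_right fun _ => ?_
  have h1 : q.line.submodule ≤ X.inducedD S q.base ↔
      q.line.rep ∈ tangentTo X.E S q.base := by
    rw [Projectivization.submodule_eq, Submodule.span_singleton_le_iff_mem]
    exact ⟨fun h => h.2, fun h => ⟨X.rep_mem q, h⟩⟩
  rw [h1, X.mem_tangentTo_iff hq.1, X.dchart_rep hq]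
  exact Submodule.smul_mem_iff _ hq.2

theorem affChart_symm_spec {z₀ : X.Z} {i : Fin (m + 1)} {y : X.E × (Fin m → ℂ)}
    (hy : y.1 ∈ (X.chart z₀).target) :
    (X.affChart z₀ i).symm y ∈ X.affSource z₀ i ∧
      X.affCoord z₀ i ((X.affChart z₀ i).symm y) = y ∧
      ((X.affChart z₀ i).symm y).base = (X.chart z₀).symm y.1 := by
  have hy' : y ∈ (X.affChart z₀ i).target := ⟨hy, trivial⟩
  have h1 := (X.affChart z₀ i).right_inv hy'
  have h2 : (X.affChart z₀ i).symm y ∈ X.affSource z₀ i := (X.affChart z₀ i).map_target hy'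
  rw [affChart_coe] at h1
  refine ⟨h2, h1, ?_⟩
  rw [← (X.chart z₀).left_inv h2.1]
  exact congrArg (X.chart z₀).symm (congrArg Prod.fst h1)

theorem mem_chartSet_prolong {T : Set X.PD} {q₀ : X.PD} {y : X.E × (Fin m → ℂ)}
    (hy : y.1 ∈ (X.chart q₀.base).target) :
    y ∈ X.prolong.chartSet q₀ T ↔ (X.affChart q₀.base (X.idx q₀)).symm y ∈ T :=
  ⟨fun h => h.2, fun h => ⟨⟨hy, trivial⟩, h⟩⟩

theorem HasEquationAt.prolong {S : Set X.Z} {q₀ : X.PD} {a : X.E → Fin (m + 1) → ℂ}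
    (h : X.HasEquationAt S q₀.base a) :
    X.prolong.HasEquationAt (X.prolongSet S) q₀
      (liftEquation (X.frame q₀.base) a (X.idx q₀)) := by
  obtain ⟨U, hU, hz, h⟩ := h
  refine ⟨U ×ˢ Set.univ, Set.prod_mono hU subset_rfl, ⟨hz, trivial⟩,
    h.lift (fun j => (X.frame_analytic q₀.base j).mono hU) (X.idx q₀) fun y hy => ?_⟩
  obtain ⟨h1, h2, h3⟩ := affChart_symm_spec (i := X.idx q₀) (hU hy)
  refine (mem_chartSet_prolong (hU hy)).trans ?_
  rw [mem_prolongSet_iff h1, h2, h3,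
    (X.chart q₀.base).right_inv (hU hy)]
  exact and_congr_left fun _ => ⟨fun h => ⟨hU hy, h⟩, fun h => h.2⟩

theorem affineVector_frame_ne_zero {z₀ : X.Z} {i : Fin (m + 1)} {y : X.E × (Fin m → ℂ)}
    (hy : y.1 ∈ (X.chart z₀).target) : affineVector (X.frame z₀) i y ≠ 0 := by
  intro h0
  have h := X.coframe_sum hy (i.insertNth 1 y.2)
  rw [show ∑ j, (i.insertNth 1 y.2 : Fin (m + 1) → ℂ) j • X.frame z₀ j y.1 = 0 from h0,
    map_zero] at h
  simpa using congrFun h i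

theorem hasEquationAt_fiber (q₀ : X.PD) :
    X.prolong.HasEquationAt {q : X.PD | X.proj q = X.proj q₀} q₀ (fun _ => Pi.single 0 1) := by
  refine ⟨(X.chart q₀.base).target ×ˢ Set.univ, subset_rfl,
    ⟨(X.chart q₀.base).map_source (mem_chart_source X.E _), trivial⟩,
    isHyperplaneEquation_fiber (X.frame q₀.base) (X.idx q₀) (X.chart q₀.base q₀.base)
      (X.chart q₀.base).open_target (fun y hy => affineVector_frame_ne_zero hy) fun y hy => ?_⟩
  obtain ⟨h1, h2, h3⟩ := affChart_symm_spec (i := X.idx q₀) hy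
  refine (mem_chartSet_prolong hy).trans ?_
  change ((X.affChart q₀.base (X.idx q₀)).symm y).base = q₀.base ↔ _
  rw [h3]
  constructor
  · intro h
    exact ((X.chart q₀.base).right_inv hy).symm.trans (congrArg (X.chart q₀.base) h)
  · intro h
    rw [h, (X.chart q₀.base).left_inv (mem_chart_source X.E _)]

/-- This supplies the incidence hypothesis of `linearIndependent_prolonged`. -/
theorem HasEquationAt.dotProduct_eq_zero {S : Set X.Z} {q : X.PD} {a : X.E → Fin (m + 1) → ℂ}
    (h : X.HasEquationAt S q.base a) (hq : q ∈ X.prolongSet S) :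
    a (X.chart q.base q.base) ⬝ᵥ ((X.idx q).insertNth 1 (X.affCoord q.base (X.idx q) q).2 :
      Fin (m + 1) → ℂ) = 0 := by
  obtain ⟨U, -, hz, h⟩ := h
  obtain ⟨h1, h2⟩ := (mem_prolongSet_iff (X.mem_affSource q)).1 hq
  exact h.eq_zero _ hz ((X.chart_mem_chartSet (mem_chart_source X.E _)).2 h1) _ h2

end Charts

end DistMfd

/-! ### From independent covectors to general position. -/

theorem hyperplanesInGeneralPosition_of_linearIndependent {m : ℕ} {V ι : Type*} [AddCommGroup V]
    [Module ℂ V] (φ : V ≃ₗ[ℂ] (Fin (m + 1) → ℂ)) {v : ι → Fin (m + 1) → ℂ}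
    (hv : LinearIndependent ℂ v) {Λ : ι → Submodule ℂ V}
    (hΛ : ∀ i x, x ∈ Λ i ↔ v i ⬝ᵥ φ x = 0) : HyperplanesInGeneralPosition Λ := by
  have hcodim : ∀ J : Finset ι, Module.finrank ℂ (V ⧸ ⨅ i ∈ J, Λ i) = J.card := by
    intro J
    let M : Matrix J (Fin (m + 1)) ℂ := Matrix.of fun i => v i
    -- The intersection is the kernel of `f`, so its codimension is the rank of a matrix with
    -- independent rows.
    let f : V →ₗ[ℂ] (J → ℂ) := M.mulVecLin ∘ₗ φ.toLinearMap
    have hker : LinearMap.ker f = ⨅ i ∈ J, Λ i := by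
      ext x
      simp only [Submodule.mem_iInf, hΛ, LinearMap.mem_ker]
      exact ⟨fun h i hi => congrFun h ⟨i, hi⟩, fun h => funext fun i => h i i.2⟩
    have hM : LinearIndependent ℂ M.row := hv.comp (fun i : J => (i : ι)) Subtype.val_injective
    rw [← hker, f.quotKerEquivRange.finrank_eq,
      LinearMap.range_comp_of_range_eq_top _ φ.range, ← Matrix.rank, hM.rank_matrix]
    simp
  refine ⟨fun i => ?_, fun J _ => hcodim J⟩
  have hi : ⨅ j ∈ ({i} : Finset ι), Λ j = Λ i := by simp
  rw [← hi, ← isSimpleModule_iff_isCoatom, isSimpleModule_iff]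
  exact is_simple_module_of_finrank_eq_one (A := ℂ) (hcodim {i})

namespace DistMfd

/-- The coordinates on `D(z)` given by the frame in the preferred chart. -/
noncomputable def coframeEquiv {m : ℕ} (X : DistMfd m) (z : X.Z) : X.D z ≃ₗ[ℂ] (Fin (m + 1) → ℂ) :=
  LinearEquiv.ofInjectiveOfFinrankEq
    ((X.coframe z (X.chart z z)).toLinearMap ∘ₗ (X.dchart z z).toLinearMap ∘ₗ (X.D z).subtype)
    (by
      intro v w h
      have hz := mem_chart_source X.E z
      have h : X.coframe z (X.chart z z) (X.dchart z z v) =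
        X.coframe z (X.chart z z) (X.dchart z z w) := h
      refine Subtype.ext ((X.dchart_bijective hz).1 ?_)
      rw [X.dchart_eq_sum hz v.2, X.dchart_eq_sum hz w.2, h])
    (by rw [X.finrank_D, Module.finrank_fin_fun])

end DistMfd

/-! ### Induction along the tower. -/

theorem exists_equations (m k : ℕ) (p : (monster m k).Z) :
    ∃ a : criticalIndices m k p → (monster m k).E → Fin (m + 1) → ℂ,
      (∀ j : criticalIndices m k p, (monster m k).HasEquationAt (babyMonster m k j p) p (a j)) ∧
      LinearIndependent ℂ fun j : criticalIndices m k p => a j ((monster m k).chart p p) := by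
  induction k with
  | zero =>
    have : IsEmpty (criticalIndices m 0 p) := ⟨fun j => j.2⟩
    exact ⟨isEmptyElim, isEmptyElim, linearIndependent_empty_type⟩
  | succ k ih =>
    let X := monster m k
    let q : X.PD := p
    obtain ⟨a, ha, hli⟩ := ih q.base
    -- The old critical hyperplanes that contain the line of `q`; only these prolong to hyperplanes
    -- through `q`.
    let ι := {j : criticalIndices m k q.base //
      q ∈ X.prolongSet (babyMonster m k j q.base)}
    let b : Option ι → X.E × (Fin m → ℂ) → Fin (m + 1) → ℂ := fun o =>
      o.elim (fun _ => Pi.single 0 1)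
        fun s => liftEquation (X.frame q.base) (a s.1) (X.idx q)
    have hb : LinearIndependent ℂ fun o => b o (X.prolong.chart q q) :=
      linearIndependent_prolonged (hli.comp (fun s : ι => s.1) Subtype.val_injective)
        (fun s => (ha s.1).dotProduct_eq_zero s.2) rfl fun s k => rfl
    -- Index `0` is the fiber through `p`; index `j + 1` is the prolongation of index `j` one level
    -- down, and `hj.1` says that the latter is critical at `q.base`.
    let g : criticalIndices m (k + 1) p → Option ι := fun j =>
      match j with
      | ⟨0, _⟩ => none
      | ⟨j + 1, hj⟩ => some ⟨⟨j, hj.1⟩, hj⟩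
    have hg : Function.Injective g := by
      rintro ⟨_ | j, hj⟩ ⟨_ | j', hj'⟩ h
      · rfl
      · exact absurd h (by simp [g])
      · exact absurd h (by simp [g])
      · obtain rfl : j = j' := congrArg (fun s : ι => (s.1 : ℕ)) (Option.some.inj h)
        rfl
    refine ⟨fun j => b (g j), ?_, hb.comp g hg⟩
    rintro ⟨_ | j, hj⟩
    · exact DistMfd.hasEquationAt_fiber q
    · exact (ha ⟨j, hj.1⟩).prolong

theorem mainTheorem6 (m k : ℕ) (p : (monster m k).Z) :
    HyperplanesInGeneralPosition
        (fun j : criticalIndices m k p => criticalHyperplane m k p j) ∧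
      (criticalIndices m k p).encard ≤ ((m + 1 : ℕ) : ℕ∞) := by
  obtain ⟨a, ha, hli⟩ := exists_equations m k p
  refine ⟨hyperplanesInGeneralPosition_of_linearIndependent
    ((monster m k).coframeEquiv p) hli fun j v => (ha j).mem_inducedD_iff j.2 v.2, ?_⟩
  have h := hli.cardinal_le_rank
  rw [rank_fin_fun] at h
  rw [← Set.toENat_cardinalMk]
  exact Cardinal.toENat_le_natCast.2 h
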